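/- Let $S_\infty$ be the group of permutations of $\{1,2,3,\dots\}$ that fix all but finitely many elements, and for a positive integer $i$ let $s_i\in S_\infty$ be the transposition exchanging $i$ and $i+1$. The Schubert polynomials $\mathfrak S_w\in\mathbb Z[x_1,x_2,x_3,\dots]$, $w\in S_\infty$, are determined recursively: $\mathfrak S_{w_0}=x_1^{n-1}x_2^{n-2}\cdots x_n^{0}$ for the long element $w_0=n(n-1)\cdots 1$ of $S_n\subset S_\infty$, for every $n\ge 1$, and $$\mathfrak S_{ws_i}=N_i\mathfrak S_w \quad\text{whenever } w(i)>w(i+1),\qquad N_i(f)=\frac{f-s_i\cdot f}{x_i-x_{i+1}},$$ where $s_i$ acts on polynomials by exchanging the variables $x_i$ and $x_{i+1}$. They form a $\mathbb Z$-basis of $\mathbb Z[x_1,x_2,x_3,\dots]$, and the Schubert structure coefficients $c_{u,v}^w\in\mathbb Z$ are defined by $$\mathfrak S_u\cdot\mathfrak S_v=\sum_{w\in S_\infty}c_{u,v}^w\,\mathfrak S_w .$$ **Corollary.** For every $v\in S_\infty$ and every positive integer $i$ there is a positive integer $k$ such that $c_{s_i,v}^{s_kv}>0$. -/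

import Mathlib

namespace Schubert

open MvPolynomial

/-- The infinite symmetric group `S_∞`: the permutations of `{1, 2, 3, …}` that fix all but
finitely many elements. Multiplication is composition, `(u * w) j = u (w j)`. -/
def SInf : Subgroup (Equiv.Perm ℕ+) where
  carrier := {σ | {j | σ j ≠ j}.Finite}
  one_mem' := by simp
  mul_mem' := by
    intro a b ha hb
    refine (Set.Finite.union ha hb).subset ?_
    intro j hj
    by_contra h
    simp only [Set.mem_union, Set.mem_ofPred_eq, not_or, not_not] at h
    exact hj (by simp [h.1, h.2])
  inv_mem' := by
    intro a ha
    refine Set.Finite.subset ha ?_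
    intro j hj h
    exact hj (by rw [Equiv.Perm.inv_eq_iff_eq, h])

/-- The simple transposition `s_i`, exchanging `i` and `i + 1`. -/
def s (i : ℕ+) : SInf :=
  ⟨Equiv.swap i (i + 1), by
    refine (Set.toFinite {i, i + 1}).subset ?_
    intro j hj
    by_contra h
    simp only [Set.mem_insert_iff, Set.mem_singleton_iff, not_or] at h
    exact hj (Equiv.swap_apply_of_ne_of_ne h.1 h.2)⟩

/-- The map `j ↦ n + 1 - j` on `{1, …, n}`, extended by the identity. -/
def reverse (n j : ℕ+) : ℕ+ := if j ≤ n then n + 1 - j else j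

theorem reverse_involutive (n : ℕ+) : Function.Involutive (reverse n) := by
  intro j
  unfold reverse
  by_cases h : j ≤ n
  · have h1 : j < n + 1 := PNat.lt_add_one_iff.2 h
    have h2 : ((n + 1 - j : ℕ+) : ℕ) = n + 1 - j := by
      rw [PNat.sub_coe, if_pos h1]; rfl
    have hj := j.pos
    have hn : (j : ℕ) ≤ n := h
    have h3 : n + 1 - j ≤ n := by
      rw [← PNat.coe_le_coe, h2]; omega
    rw [if_pos h, if_pos h3]
    apply PNat.eq
    rw [PNat.sub_coe, if_pos (PNat.lt_add_one_iff.2 h3), h2, PNat.add_coe, PNat.one_coe]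
    omega
  · simp [h]

/-- The long element `w₀ = n (n-1) ⋯ 1` of `S_n`, as an element of `S_∞`. -/
def longElement (n : ℕ+) : SInf :=
  ⟨(reverse_involutive n).toPerm (reverse n), by
    refine (Set.finite_Iic n).subset ?_
    intro j hj
    by_contra h
    exact hj (if_neg h)⟩

/-- The action of `s_i` on `ℤ[x₁, x₂, x₃, …]`, exchanging the variables `x_i` and `x_{i+1}`. -/
noncomputable def swapVars (i : ℕ+) (f : MvPolynomial ℕ+ ℤ) : MvPolynomial ℕ+ ℤ :=
  rename (Equiv.swap i (i + 1)) f

theorem dvd_sub_swapVars (i : ℕ+) (f : MvPolynomial ℕ+ ℤ) :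
    (X i - X (i + 1) : MvPolynomial ℕ+ ℤ) ∣ f - swapVars i f := by
  unfold swapVars
  induction f using MvPolynomial.induction_on with
  | C a => simp
  | add p q hp hq =>
    rw [map_add, add_sub_add_comm]
    exact dvd_add hp hq
  | mul_X p j hp =>
    have hj : (X i - X (i + 1) : MvPolynomial ℕ+ ℤ) ∣
        X j - X (Equiv.swap i (i + 1) j) := by
      by_cases h1 : j = i
      · subst h1; simp
      · by_cases h2 : j = i + 1
        · subst h2
          rw [Equiv.swap_apply_right, ← neg_sub (X i), dvd_neg]
        · rw [Equiv.swap_apply_of_ne_of_ne h1 h2, sub_self]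
          exact dvd_zero _
    rw [map_mul, rename_X]
    have e : p * X j - rename (Equiv.swap i (i + 1)) p * X (Equiv.swap i (i + 1) j)
        = (p - rename (Equiv.swap i (i + 1)) p) * X j
          + rename (Equiv.swap i (i + 1)) p * (X j - X (Equiv.swap i (i + 1) j)) := by ring
    rw [e]
    exact dvd_add (hp.mul_right _) (hj.mul_left _)

/-- The Newton divided difference operator `N_i f = (f - s_i f) / (x_i - x_{i+1})`. -/
noncomputable def N (i : ℕ+) (f : MvPolynomial ℕ+ ℤ) : MvPolynomial ℕ+ ℤ :=
  (dvd_sub_swapVars i f).choose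

theorem mul_N (i : ℕ+) (f : MvPolynomial ℕ+ ℤ) :
    (X i - X (i + 1)) * N i f = f - swapVars i f :=
  (dvd_sub_swapVars i f).choose_spec.symm

/-- `IsSchubert w f`: the recursion for Schubert polynomials assigns `f` to `w`. It starts from
`x₁^(n-1) x₂^(n-2) ⋯ x_n^0` at the long element of `S_n`, for each `n ≥ 1`, and passes from `w`
to `w s_i` by `N_i` whenever `w(i) > w(i+1)`. -/
inductive IsSchubert : SInf → MvPolynomial ℕ+ ℤ → Prop
  | long (n : ℕ+) :
      IsSchubert (longElement n) (∏ j ∈ Finset.Icc 1 n, X j ^ ((n : ℕ) - (j : ℕ)))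
  | step (w : SInf) (f : MvPolynomial ℕ+ ℤ) (i : ℕ+) (hf : IsSchubert w f)
      (hi : (w : Equiv.Perm ℕ+) (i + 1) < (w : Equiv.Perm ℕ+) i) :
      IsSchubert (w * s i) (N i f)

open Classical in
/-- The Schubert polynomial of `w`: the one polynomial that the recursion assigns to `w`.
(That there is exactly one is a classical fact, so the value `0` is never used.) -/
noncomputable def schubert (w : SInf) : MvPolynomial ℕ+ ℤ :=
  if h : ∃! f, IsSchubert w f then h.choose else 0

open Classical in
/-- The Schubert structure coefficients `c_{u,v}^w`, as a finitely supported function of `w`: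
the one family `c` of integers with `𝔖_u 𝔖_v = ∑_w c_w 𝔖_w`. (Schubert polynomials form
a `ℤ`-basis of `ℤ[x₁, x₂, …]`, so the value `0` is never used.) -/
noncomputable def structureCoeff (u v : SInf) : SInf →₀ ℤ :=
  if h : ∃! c : SInf →₀ ℤ, schubert u * schubert v = c.sum (fun w a => a • schubert w)
  then h.choose else 0

end Schubert

namespace Schubert

open MvPolynomial

/-! Here `𝔖_{s_i} = x_1 + ⋯ + x_i` (`schubert_s`), so the coefficients sought come from the products
`x_r 𝔖_v` with `r ≤ i`. If the value `k` stands to the left of `k + 1` in `v`, the coefficient of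
`𝔖_{s_k v}` in `x_r 𝔖_v` is `[v(r) = k] - [v(r) = k + 1]` (`repr_X_mul_schubert`). Let `k` be the
largest of `v(1), …, v(i)`. Then `k + 1` stands to the right of position `i`, and summing over `r ≤
i` gives coefficient exactly 1.

The tool for coefficients is `repr_N_mul_s`: at a descent `i` of `w`, the coefficient of `𝔖_w` in
`f` is that of `𝔖_{w s_i}` in `N_i f`. With the Leibniz rule it gives an induction on `v`.

Since `schubert` and `structureCoeff` default to 0, the classical foundations are needed too. The
recursion is consistent inside each `S_n` by the commutation and braid relations of the `N_i`
(`IsSchubertIn.unique`) and from `S_n` to `S_{n+1}` (`IsSchubertIn.succ`). The polynomials form a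
basis by `linearIndependent_schubert` and `exists_eq_linearCombination`. -/

theorem X_sub_X_ne_zero {a b : ℕ+} (h : a ≠ b) : (X a - X b : MvPolynomial ℕ+ ℤ) ≠ 0 :=
  sub_ne_zero.2 fun e => h (X_injective e)

theorem ne_add_one (i : ℕ+) : i ≠ i + 1 := (PNat.lt_add_right i 1).ne

/-! ### The variable swaps -/

theorem swapVars_add (i : ℕ+) (f g : MvPolynomial ℕ+ ℤ) :
    swapVars i (f + g) = swapVars i f + swapVars i g := map_add _ f g

theorem swapVars_sub (i : ℕ+) (f g : MvPolynomial ℕ+ ℤ) :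
    swapVars i (f - g) = swapVars i f - swapVars i g := map_sub _ f g

theorem swapVars_mul (i : ℕ+) (f g : MvPolynomial ℕ+ ℤ) :
    swapVars i (f * g) = swapVars i f * swapVars i g := map_mul _ f g

theorem swapVars_X (i j : ℕ+) : swapVars i (X j) = X (Equiv.swap i (i + 1) j) := rename_X _ _

theorem swapVars_X_left (i : ℕ+) : swapVars i (X i) = X (i + 1) := by
  rw [swapVars_X, Equiv.swap_apply_left]

theorem swapVars_X_right (i : ℕ+) : swapVars i (X (i + 1)) = X i := by
  rw [swapVars_X, Equiv.swap_apply_right]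

theorem swapVars_X_of_ne {i j : ℕ+} (h : j ≠ i) (h' : j ≠ i + 1) : swapVars i (X j) = X j := by
  rw [swapVars_X, Equiv.swap_apply_of_ne_of_ne h h']

theorem swapVars_swapVars (i : ℕ+) (f : MvPolynomial ℕ+ ℤ) : swapVars i (swapVars i f) = f := by
  unfold swapVars
  rw [rename_rename, ← Equiv.Perm.coe_mul, Equiv.swap_mul_self, Equiv.Perm.coe_one, rename_id_apply]

theorem swap_mul_swap_of_far {i j : ℕ+} (h : i + 1 < j) :
    Equiv.swap i (i + 1) * Equiv.swap j (j + 1) = Equiv.swap j (j + 1) * Equiv.swap i (i + 1) := by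
  have h1 : i < i + 1 := PNat.lt_add_right i 1
  have h2 : j < j + 1 := PNat.lt_add_right j 1
  refine (Equiv.Perm.Disjoint.commute ?_).eq
  exact Equiv.Perm.disjoint_swap_swap (by
    simp [h1.ne, h2.ne, h.ne, (h1.trans h).ne, (h.trans h2).ne, (h1.trans (h.trans h2)).ne])

theorem swap_braid (i : ℕ+) :
    Equiv.swap i (i + 1) * Equiv.swap (i + 1) (i + 1 + 1) * Equiv.swap i (i + 1) =
      Equiv.swap (i + 1) (i + 1 + 1) * Equiv.swap i (i + 1) * Equiv.swap (i + 1) (i + 1 + 1) := by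
  have h1 : i < i + 1 := PNat.lt_add_right i 1
  have h2 : i + 1 < i + 1 + 1 := PNat.lt_add_right _ 1
  rw [Equiv.swap_mul_swap_mul_swap h1.ne (h1.trans h2).ne, Equiv.swap_comm i (i + 1),
    Equiv.swap_comm (i + 1) (i + 1 + 1),
    Equiv.swap_mul_swap_mul_swap h2.ne' (h1.trans h2).ne', Equiv.swap_comm]

theorem swapVars_comm {i j : ℕ+} (h : i + 1 < j) (f : MvPolynomial ℕ+ ℤ) :
    swapVars i (swapVars j f) = swapVars j (swapVars i f) := by
  unfold swapVars
  rw [rename_rename, rename_rename, ← Equiv.Perm.coe_mul, ← Equiv.Perm.coe_mul,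
    swap_mul_swap_of_far h]

theorem swapVars_braid (i : ℕ+) (f : MvPolynomial ℕ+ ℤ) :
    swapVars i (swapVars (i + 1) (swapVars i f)) =
      swapVars (i + 1) (swapVars i (swapVars (i + 1) f)) := by
  unfold swapVars
  simp only [rename_rename, ← Equiv.Perm.coe_mul, ← mul_assoc]
  rw [swap_braid]

/-! ### The divided difference operators -/

theorem N_eq_of_mul_eq {i : ℕ+} {f g : MvPolynomial ℕ+ ℤ}
    (h : (X i - X (i + 1)) * g = f - swapVars i f) : N i f = g :=
  mul_left_cancel₀ (X_sub_X_ne_zero (ne_add_one i)) ((mul_N i f).trans h.symm)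

theorem N_eq_zero_iff {i : ℕ+} {f : MvPolynomial ℕ+ ℤ} : N i f = 0 ↔ swapVars i f = f := by
  constructor
  · intro h
    have := mul_N i f
    rw [h, mul_zero] at this
    exact (sub_eq_zero.1 this.symm).symm
  · intro h
    exact N_eq_of_mul_eq (by rw [h, mul_zero, sub_self])

/-- `N_i` as a linear map. -/
noncomputable def NLin (i : ℕ+) : MvPolynomial ℕ+ ℤ →ₗ[ℤ] MvPolynomial ℕ+ ℤ where
  toFun := N i
  map_add' f g := N_eq_of_mul_eq (by rw [mul_add, mul_N, mul_N, swapVars_add]; ring)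
  map_smul' a f := N_eq_of_mul_eq (by
    simp only [swapVars, map_smul, RingHom.id_apply, mul_smul_comm, mul_N, smul_sub])

@[simp] theorem NLin_apply (i : ℕ+) (f : MvPolynomial ℕ+ ℤ) : NLin i f = N i f := rfl

theorem N_zero (i : ℕ+) : N i 0 = 0 := (NLin i).map_zero

theorem N_C (i : ℕ+) (a : ℤ) : N i (C a) = 0 := N_eq_zero_iff.2 (rename_C _ _)

theorem N_mul (i : ℕ+) (f g : MvPolynomial ℕ+ ℤ) :
    N i (f * g) = N i f * g + swapVars i f * N i g := by
  apply N_eq_of_mul_eq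
  rw [swapVars_mul]
  linear_combination g * mul_N i f + swapVars i f * mul_N i g

/-- Numerator and denominator of the quotient both change sign under `s_i`. -/
theorem swapVars_N (i : ℕ+) (f : MvPolynomial ℕ+ ℤ) : swapVars i (N i f) = N i f := by
  apply mul_left_cancel₀ (X_sub_X_ne_zero (ne_add_one i))
  have h := congrArg (swapVars i) (mul_N i f)
  rw [swapVars_mul, swapVars_sub, swapVars_sub, swapVars_X_left, swapVars_X_right,
    swapVars_swapVars] at h
  linear_combination -h - mul_N i f

theorem N_N (i : ℕ+) (f : MvPolynomial ℕ+ ℤ) : N i (N i f) = 0 :=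
  N_eq_zero_iff.2 (swapVars_N i f)

theorem N_X (i j : ℕ+) :
    N i (X j) = C ((if j = i then 1 else 0) - (if j = i + 1 then 1 else 0)) := by
  apply N_eq_of_mul_eq
  by_cases h : j = i
  · subst h
    simp [swapVars_X_left, ne_add_one]
  by_cases h' : j = i + 1
  · subst h'
    simp [swapVars_X_right, (ne_add_one i).symm]
  · simp [swapVars_X_of_ne h h', h, h']

theorem N_comm {i j : ℕ+} (h : i + 1 < j) (f : MvPolynomial ℕ+ ℤ) :
    N i (N j f) = N j (N i f) := by
  have h1 : i < i + 1 := PNat.lt_add_right i 1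
  have h2 : j < j + 1 := PNat.lt_add_right j 1
  have e1 := mul_N j f
  have e2 := mul_N i f
  have e3 := mul_N i (N j f)
  have e4 := mul_N j (N i f)
  have e5 := congrArg (swapVars i) e1
  have e6 := congrArg (swapVars j) e2
  rw [swapVars_mul, swapVars_sub, swapVars_sub,
    swapVars_X_of_ne (h1.trans h).ne' h.ne',
    swapVars_X_of_ne (h1.trans (h.trans h2)).ne' (h.trans h2).ne'] at e5
  rw [swapVars_mul, swapVars_sub, swapVars_sub,
    swapVars_X_of_ne (h1.trans h).ne (h1.trans (h.trans h2)).ne,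
    swapVars_X_of_ne h.ne (h.trans h2).ne, ← swapVars_comm h] at e6
  apply mul_left_cancel₀ (X_sub_X_ne_zero (ne_add_one i))
  apply mul_left_cancel₀ (X_sub_X_ne_zero (ne_add_one j))
  linear_combination (X j - X (j + 1)) * e3 - (X i - X (i + 1)) * e4 + e1 - e5 - e2 + e6

/-- The threefold divided difference is the antisymmetrization over the `S_3` permuting three
consecutive variables, divided by their Vandermonde product. The other order of operators gives the
same six terms up to the braid relation in the last one. -/
theorem mul_N_N_N_left (i : ℕ+) (f : MvPolynomial ℕ+ ℤ) :
    (X i - X (i + 1)) * (X i - X (i + 1 + 1)) * (X (i + 1) - X (i + 1 + 1)) *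
        N i (N (i + 1) (N i f)) =
      f - swapVars i f - swapVars (i + 1) f + swapVars (i + 1) (swapVars i f)
        + swapVars i (swapVars (i + 1) f) - swapVars i (swapVars (i + 1) (swapVars i f)) := by
  have h1 : i < i + 1 := PNat.lt_add_right i 1
  have h2 : i + 1 < i + 1 + 1 := PNat.lt_add_right _ 1
  have e1 := mul_N i f
  have e2 := mul_N (i + 1) (N i f)
  have e3 := mul_N i (N (i + 1) (N i f))
  have e4 := congrArg (swapVars (i + 1)) e1
  rw [swapVars_mul, swapVars_sub, swapVars_sub, swapVars_X_left,
    swapVars_X_of_ne h1.ne (h1.trans h2).ne] at e4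
  have e5 := congrArg (swapVars i) e2
  have e6 := congrArg (swapVars i) e4
  simp only [swapVars_mul, swapVars_sub, swapVars_X_left, swapVars_X_right,
    swapVars_X_of_ne (h1.trans h2).ne' h2.ne', swapVars_N] at e5 e6
  apply mul_left_cancel₀ (X_sub_X_ne_zero (ne_add_one i))
  linear_combination (X i - X (i + 1)) * (X i - X (i + 1 + 1)) * (X (i + 1) - X (i + 1 + 1)) * e3
    + (X i - X (i + 1)) * (X i - X (i + 1 + 1)) * e2
    - (X i - X (i + 1)) * (X (i + 1) - X (i + 1 + 1)) * e5
    + (X i - X (i + 1 + 1)) * e1 - (X (i + 1) - X (i + 1 + 1)) * e1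
    - (X i - X (i + 1)) * e4 + (X i - X (i + 1)) * e6

theorem mul_N_N_N_right (i : ℕ+) (f : MvPolynomial ℕ+ ℤ) :
    (X i - X (i + 1)) * (X i - X (i + 1 + 1)) * (X (i + 1) - X (i + 1 + 1)) *
        N (i + 1) (N i (N (i + 1) f)) =
      f - swapVars i f - swapVars (i + 1) f + swapVars (i + 1) (swapVars i f)
        + swapVars i (swapVars (i + 1) f)
        - swapVars (i + 1) (swapVars i (swapVars (i + 1) f)) := by
  have h1 : i < i + 1 := PNat.lt_add_right i 1
  have h2 : i + 1 < i + 1 + 1 := PNat.lt_add_right _ 1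
  have e1 := mul_N (i + 1) f
  have e2 := mul_N i (N (i + 1) f)
  have e3 := mul_N (i + 1) (N i (N (i + 1) f))
  have e4 := congrArg (swapVars i) e1
  rw [swapVars_mul, swapVars_sub, swapVars_sub, swapVars_X_right,
    swapVars_X_of_ne (h1.trans h2).ne' h2.ne'] at e4
  have e5 := congrArg (swapVars (i + 1)) e2
  have e6 := congrArg (swapVars (i + 1)) e4
  simp only [swapVars_mul, swapVars_sub, swapVars_X_left, swapVars_X_right,
    swapVars_X_of_ne h1.ne (h1.trans h2).ne, swapVars_N] at e5 e6
  apply mul_left_cancel₀ (X_sub_X_ne_zero (ne_add_one (i + 1)))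
  linear_combination (X i - X (i + 1)) * (X i - X (i + 1 + 1)) * (X (i + 1) - X (i + 1 + 1)) * e3
    + (X (i + 1) - X (i + 1 + 1)) * (X i - X (i + 1 + 1)) * e2
    - (X i - X (i + 1)) * (X (i + 1) - X (i + 1 + 1)) * e5
    + (X i - X (i + 1 + 1)) * e1 - (X i - X (i + 1)) * e1
    - (X (i + 1) - X (i + 1 + 1)) * e4 + (X (i + 1) - X (i + 1 + 1)) * e6

theorem N_braid (i : ℕ+) (f : MvPolynomial ℕ+ ℤ) :
    N i (N (i + 1) (N i f)) = N (i + 1) (N i (N (i + 1) f)) := by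
  have h1 : i < i + 1 := PNat.lt_add_right i 1
  have h2 : i + 1 < i + 1 + 1 := PNat.lt_add_right _ 1
  have h : (X i - X (i + 1)) * (X i - X (i + 1 + 1)) * (X (i + 1) - X (i + 1 + 1)) ≠
      (0 : MvPolynomial ℕ+ ℤ) :=
    mul_ne_zero (mul_ne_zero (X_sub_X_ne_zero h1.ne) (X_sub_X_ne_zero (h1.trans h2).ne))
      (X_sub_X_ne_zero h2.ne)
  apply mul_left_cancel₀ h
  rw [mul_N_N_N_left, mul_N_N_N_right, swapVars_braid]

theorem totalDegree_N_lt {i : ℕ+} {f : MvPolynomial ℕ+ ℤ} (h : N i f ≠ 0) :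
    (N i f).totalDegree < f.totalDegree := by
  have h0 := X_sub_X_ne_zero (ne_add_one i)
  have hd : (X i - X (i + 1) : MvPolynomial ℕ+ ℤ).totalDegree = 1 :=
    ((isHomogeneous_X ℤ i).sub (isHomogeneous_X ℤ (i + 1))).totalDegree h0
  have e := congrArg totalDegree (mul_N i f)
  rw [totalDegree_mul_of_isDomain h0 h, hd] at e
  have h1 := totalDegree_sub f (swapVars i f)
  have h2 : (swapVars i f).totalDegree ≤ f.totalDegree := totalDegree_rename_le _ f
  rw [max_eq_left h2] at h1
  omega

/-- Splitting off one variable by the Leibniz rule reduces the degree, and `N_i x_j` is a constant.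
-/
theorem isHomogeneous_N_monomial (i : ℕ+) (d : ℕ) :
    ∀ m : ℕ+ →₀ ℕ, m.degree = d + 1 →
      (N i (monomial m 1 : MvPolynomial ℕ+ ℤ)).IsHomogeneous d := by
  induction d with | zero => ?_ | succ d ih => ?_
  all_goals
    intro m hm
    obtain ⟨j, hj⟩ : ∃ j, m j ≠ 0 := by
      by_contra! h
      have : m = 0 := Finsupp.ext h
      simp [this] at hm
    have hle : Finsupp.single j 1 ≤ m := by
      simpa [Finsupp.single_le_iff] using Nat.one_le_iff_ne_zero.2 hj
    obtain ⟨m', rfl⟩ := exists_add_of_le hle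
    rw [map_add, Finsupp.degree_single, add_comm, Nat.add_right_cancel_iff] at hm
    have e : (monomial (Finsupp.single j 1 + m') 1 : MvPolynomial ℕ+ ℤ) =
        X j * monomial m' 1 := by
      rw [X, monomial_mul, one_mul]
    rw [e, N_mul, N_X, swapVars_X]
    refine IsHomogeneous.add ((isHomogeneous_monomial (1 : ℤ) hm).C_mul _) ?_
  · rw [(Finsupp.degree_eq_zero_iff m').1 hm, show monomial 0 (1 : ℤ) = C 1 from rfl, N_C, mul_zero]
    exact isHomogeneous_zero _ _ _
  · rw [add_comm d 1]
    exact (isHomogeneous_X _ _).mul (ih m' hm)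

theorem isHomogeneous_N {i : ℕ+} {f : MvPolynomial ℕ+ ℤ} {d : ℕ} (h : f.IsHomogeneous (d + 1)) :
    (N i f).IsHomogeneous d := by
  rw [f.as_sum, ← NLin_apply, map_sum]
  refine IsHomogeneous.sum _ _ _ fun m hm => ?_
  have e : monomial m (coeff m f) = coeff m f • (monomial m 1 : MvPolynomial ℕ+ ℤ) := by
    rw [smul_monomial, smul_eq_mul, mul_one]
  rw [e, map_smul, NLin_apply, smul_eq_C_mul]
  refine (isHomogeneous_N_monomial i d m ?_).C_mul _
  rw [Finsupp.degree_eq_weight_one]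
  exact h (mem_support_iff.1 hm)

/-- Such an `f` is invariant under every `s_i`, so with `x_i` it also involves `x_{i+1}`; having
finitely many variables, it has none. -/
theorem eq_C_of_forall_N_eq_zero {f : MvPolynomial ℕ+ ℤ} (h : ∀ i, N i f = 0) :
    ∃ a, f = C a := by
  classical
  have key : ∀ i ∈ f.vars, i + 1 ∈ f.vars := by
    intro i hi
    have h1 : f.vars ⊆ f.vars.image (Equiv.swap i (i + 1)) := by
      have := vars_rename (Equiv.swap i (i + 1)) f
      rwa [show rename (Equiv.swap i (i + 1)) f = f from N_eq_zero_iff.1 (h i)] at this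
    obtain ⟨j, hj, e⟩ := Finset.mem_image.1 (h1 hi)
    rw [Equiv.swap_apply_eq_iff, Equiv.swap_apply_left] at e
    exact e ▸ hj
  have hv : f.vars = ∅ := by
    by_contra hne
    have hne' := Finset.nonempty_iff_ne_empty.2 hne
    have := f.vars.le_max' _ (key _ (f.vars.max'_mem hne'))
    exact absurd this (not_le.2 (PNat.lt_add_right _ 1))
  exact ⟨_, vars_eq_empty_iff_eq_C.1 hv⟩

/-! ### Simple transpositions -/

theorem coe_mul_s_apply (w : SInf) (i j : ℕ+) :
    ((w * s i : SInf) : Equiv.Perm ℕ+) j = (w : Equiv.Perm ℕ+) (Equiv.swap i (i + 1) j) := rfl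

theorem mul_s_left (w : SInf) (i : ℕ+) :
    ((w * s i : SInf) : Equiv.Perm ℕ+) i = (w : Equiv.Perm ℕ+) (i + 1) := by
  rw [coe_mul_s_apply, Equiv.swap_apply_left]

theorem mul_s_right (w : SInf) (i : ℕ+) :
    ((w * s i : SInf) : Equiv.Perm ℕ+) (i + 1) = (w : Equiv.Perm ℕ+) i := by
  rw [coe_mul_s_apply, Equiv.swap_apply_right]

theorem mul_s_of_ne (w : SInf) {i j : ℕ+} (h : j ≠ i) (h' : j ≠ i + 1) :
    ((w * s i : SInf) : Equiv.Perm ℕ+) j = (w : Equiv.Perm ℕ+) j := by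
  rw [coe_mul_s_apply, Equiv.swap_apply_of_ne_of_ne h h']

theorem s_mul_s (i : ℕ+) : s i * s i = 1 := Subtype.ext (Equiv.swap_mul_self _ _)

theorem mul_s_mul_s (w : SInf) (i : ℕ+) : w * s i * s i = w := by
  rw [mul_assoc, s_mul_s, mul_one]

theorem s_comm {i j : ℕ+} (h : i + 1 < j) : s i * s j = s j * s i :=
  Subtype.ext (swap_mul_swap_of_far h)

theorem s_braid (i : ℕ+) : s i * s (i + 1) * s i = s (i + 1) * s i * s (i + 1) :=
  Subtype.ext (swap_braid i)

/-- `w` has a descent at `i`. -/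
def Desc (w : SInf) (i : ℕ+) : Prop := (w : Equiv.Perm ℕ+) (i + 1) < (w : Equiv.Perm ℕ+) i

theorem not_desc_iff {w : SInf} {i : ℕ+} :
    ¬ Desc w i ↔ (w : Equiv.Perm ℕ+) i < (w : Equiv.Perm ℕ+) (i + 1) := by
  rw [Desc, not_lt]
  exact ⟨fun h => h.lt_of_ne fun e => ne_add_one i ((w : Equiv.Perm ℕ+).injective e), le_of_lt⟩

theorem desc_mul_s {w : SInf} {i : ℕ+} : Desc (w * s i) i ↔ ¬ Desc w i := by
  rw [not_desc_iff, Desc, mul_s_left, mul_s_right]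

theorem desc_mul_s_of_far {w : SInf} {i j : ℕ+} (h : i + 1 < j) :
    Desc (w * s i) j ↔ Desc w j := by
  have h1 : i < i + 1 := PNat.lt_add_right i 1
  have h2 : j < j + 1 := PNat.lt_add_right j 1
  rw [Desc, mul_s_of_ne w (h1.trans h).ne' h.ne',
    mul_s_of_ne w (h1.trans (h.trans h2)).ne' (h.trans h2).ne', Desc]

theorem desc_mul_s_of_far' {w : SInf} {i j : ℕ+} (h : i + 1 < j) :
    Desc (w * s j) i ↔ Desc w i := by
  have h1 : i < i + 1 := PNat.lt_add_right i 1
  have h2 : j < j + 1 := PNat.lt_add_right j 1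
  rw [Desc, mul_s_of_ne w (h1.trans h).ne (h1.trans (h.trans h2)).ne,
    mul_s_of_ne w h.ne (h.trans h2).ne, Desc]

/-- The symmetric group `S_n` inside `S_∞`. -/
def Fixes (n : ℕ+) (w : SInf) : Prop := ∀ j, n < j → (w : Equiv.Perm ℕ+) j = j

theorem exists_fixes (w : SInf) : ∃ n, Fixes n w := by
  have hw : {j | (w : Equiv.Perm ℕ+) j ≠ j}.Finite := w.2
  obtain ⟨n, hn⟩ := hw.bddAbove
  refine ⟨n, fun j hj => ?_⟩
  by_contra h
  exact absurd (hn h) (not_le.2 hj)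

theorem Fixes.apply_le {n : ℕ+} {w : SInf} (h : Fixes n w) {j : ℕ+} (hj : j ≤ n) :
    (w : Equiv.Perm ℕ+) j ≤ n := by
  by_contra! hlt
  have := (w : Equiv.Perm ℕ+).injective (h _ hlt)
  rw [this] at hlt
  exact absurd hj (not_le.2 hlt)

theorem fixes_s {n i : ℕ+} (h : i < n) : Fixes n (s i) := fun _ hj =>
  Equiv.swap_apply_of_ne_of_ne (h.trans hj).ne' (lt_of_le_of_lt (PNat.add_one_le_iff.2 h) hj).ne'

theorem Fixes.mul {n : ℕ+} {u w : SInf} (hu : Fixes n u) (hw : Fixes n w) : Fixes n (u * w) := by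
  intro j hj
  change (u : Equiv.Perm ℕ+) ((w : Equiv.Perm ℕ+) j) = j
  rw [hw j hj, hu j hj]

theorem Fixes.mul_s {n i : ℕ+} {w : SInf} (hw : Fixes n w) (h : i < n) : Fixes n (w * s i) :=
  hw.mul (fixes_s h)

theorem fixes_longElement (n : ℕ+) : Fixes n (longElement n) := fun _ hj => if_neg (not_le.2 hj)

theorem longElement_apply {n j : ℕ+} (h : j ≤ n) :
    ((longElement n : SInf) : Equiv.Perm ℕ+) j = n + 1 - j := if_pos h

theorem coe_longElement_apply {n j : ℕ+} (h : j ≤ n) :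
    ((((longElement n : SInf) : Equiv.Perm ℕ+) j : ℕ+) : ℕ) = n + 1 - j := by
  rw [longElement_apply h, PNat.sub_coe, if_pos (PNat.lt_add_one_iff.2 h)]
  rfl

theorem longElement_mul_self (n : ℕ+) : longElement n * longElement n = 1 :=
  Subtype.ext (Equiv.ext (reverse_involutive n))

theorem Fixes.lt_of_desc {n i : ℕ+} {w : SInf} (hw : Fixes n w) (h : Desc w i) : i < n := by
  by_contra! hle
  have h1 : i < i + 1 := PNat.lt_add_right i 1
  rw [Desc, hw _ (hle.trans_lt h1)] at h
  rcases hle.eq_or_lt with e | hlt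
  · subst e
    exact absurd (hw.apply_le le_rfl) (not_le.2 (h1.trans h))
  · rw [hw _ hlt] at h
    exact absurd h1 (not_lt.2 h.le)

theorem desc_longElement {n i : ℕ+} (h : i < n) : Desc (longElement n) i := by
  have h1 : i + 1 ≤ n := PNat.add_one_le_iff.2 h
  rw [Desc, ← PNat.coe_lt_coe, coe_longElement_apply h1, coe_longElement_apply h.le,
    PNat.add_coe, PNat.one_coe]
  have : (i : ℕ) < n := h
  omega

/-- Without descents `w` is an order automorphism of a well-order, hence trivial. -/
theorem eq_one_of_forall_not_desc {w : SInf} (h : ∀ i, ¬ Desc w i) : w = 1 := by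
  have hm : StrictMono (w : Equiv.Perm ℕ+) := by
    intro a b hab
    induction b using PNat.recOn with
    | one => exact absurd hab (not_lt.2 one_le)
    | succ b ih =>
      have hb := not_desc_iff.1 (h b)
      rcases (PNat.lt_add_one_iff.1 hab).eq_or_lt with e | e
      · exact e ▸ hb
      · exact (ih e).trans hb
  let e : ℕ+ ≃o ℕ+ := hm.orderIsoOfSurjective _ (w : Equiv.Perm ℕ+).surjective
  have he : e = OrderIso.refl ℕ+ := Subsingleton.elim _ _
  apply Subtype.ext
  apply Equiv.ext
  intro j
  exact congrArg (fun f : ℕ+ ≃o ℕ+ => f j) he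

theorem exists_desc {w : SInf} (h : w ≠ 1) : ∃ i, Desc w i := by
  by_contra! h'
  exact h (eq_one_of_forall_not_desc h')

theorem Fixes.eq_longElement {n : ℕ+} {w : SInf} (hw : Fixes n w) (h : ∀ i < n, Desc w i) :
    w = longElement n := by
  have key : longElement n * w = 1 := by
    apply eq_one_of_forall_not_desc
    intro i hi
    have hin := ((fixes_longElement n).mul hw).lt_of_desc hi
    have h1 := h i hin
    have h2 := hw.apply_le hin.le
    have h3 := hw.apply_le (PNat.add_one_le_iff.2 hin)
    change (longElement n : Equiv.Perm ℕ+) ((w : Equiv.Perm ℕ+) (i + 1)) <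
      (longElement n : Equiv.Perm ℕ+) ((w : Equiv.Perm ℕ+) i) at hi
    rw [← PNat.coe_lt_coe, coe_longElement_apply h2, coe_longElement_apply h3] at hi
    have h4 : ((w : Equiv.Perm ℕ+) (i + 1) : ℕ) < (w : Equiv.Perm ℕ+) i := h1
    omega
  calc w = longElement n * (longElement n * w) := by
        rw [← mul_assoc, longElement_mul_self, one_mul]
    _ = longElement n := by rw [key, mul_one]

/-! ### A statistic that drops along ascents -/

/-- The weighted sum `∑ j w(j)` over `j ≤ n`. -/
def weightedSum (n : ℕ+) (w : SInf) : ℕ :=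
  ∑ j ∈ Finset.Icc 1 n, (j : ℕ) * (w : Equiv.Perm ℕ+) j

theorem weightedSum_mul_s {n i : ℕ+} (w : SInf) (h : i < n) :
    (weightedSum n (w * s i) : ℤ) = weightedSum n w +
      ((w : Equiv.Perm ℕ+) i : ℤ) - ((w : Equiv.Perm ℕ+) (i + 1) : ℤ) := by
  have h0 : i ∈ Finset.Icc 1 n := Finset.mem_Icc.2 ⟨one_le, h.le⟩
  have h1 : i + 1 ∈ (Finset.Icc 1 n).erase i :=
    Finset.mem_erase.2 ⟨(ne_add_one i).symm,
      Finset.mem_Icc.2 ⟨one_le, PNat.add_one_le_iff.2 h⟩⟩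
  have e : ∀ u : SInf, (weightedSum n u : ℤ) = (i : ℤ) * (u : Equiv.Perm ℕ+) i +
      ((i : ℤ) + 1) * (u : Equiv.Perm ℕ+) (i + 1) +
      ∑ j ∈ ((Finset.Icc 1 n).erase i).erase (i + 1), (j : ℤ) * (u : Equiv.Perm ℕ+) j := by
    intro u
    rw [weightedSum, Nat.cast_sum, ← Finset.add_sum_erase _ _ h0, ← Finset.add_sum_erase _ _ h1]
    push_cast
    ring
  rw [e, e w, mul_s_left, mul_s_right, Finset.sum_congr rfl (fun j hj => ?_)]
  · ring
  · obtain ⟨hj, hj'⟩ := Finset.mem_erase.1 hj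
    rw [mul_s_of_ne w (Finset.mem_erase.1 hj').1 hj]

/-- The weighted sum replaces the length, in reverse order: it falls as permutations climb towards
the long element, which makes it a measure for inductions that follow ascents. -/
theorem weightedSum_lt {n i : ℕ+} {w : SInf} (h : i < n) (hw : ¬ Desc w i) :
    weightedSum n (w * s i) < weightedSum n w := by
  have h1 := weightedSum_mul_s w h
  have h2 : ((w : Equiv.Perm ℕ+) i : ℕ) < (w : Equiv.Perm ℕ+) (i + 1) := not_desc_iff.1 hw
  omega

theorem weightedSum_le {n : ℕ+} {w : SInf} (h : Fixes n w) :
    weightedSum n w ≤ ∑ j ∈ Finset.Icc 1 n, (j : ℕ) * n :=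
  Finset.sum_le_sum fun _ hj => Nat.mul_le_mul_left _ (h.apply_le (Finset.mem_Icc.1 hj).2)

/-- Induction from shorter to longer elements of `S_∞`. -/
theorem desc_induction {P : SInf → Prop} (w : SInf)
    (h : ∀ w, (∀ i, Desc w i → P (w * s i)) → P w) : P w := by
  obtain ⟨n, hn⟩ := exists_fixes w
  induction hk : (∑ j ∈ Finset.Icc 1 n, (j : ℕ) * n) - weightedSum n w
    using Nat.strong_induction_on generalizing w with
  | _ k ih =>
    apply h
    intro i hi
    have hin := hn.lt_of_desc hi
    have h1 := weightedSum_lt (w := w * s i) hin (by rwa [desc_mul_s, not_not])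
    rw [mul_s_mul_s] at h1
    have h2 := weightedSum_le (hn.mul_s hin)
    exact ih _ (by omega) _ (hn.mul_s hin) rfl

/-! ### The recursion inside `S_n` -/

/-- The monomial `x₁^(n-1) x₂^(n-2) ⋯ x_n^0`. -/
noncomputable def longMonomial (n : ℕ+) : MvPolynomial ℕ+ ℤ :=
  ∏ j ∈ Finset.Icc 1 n, X j ^ ((n : ℕ) - (j : ℕ))

/-- The part of the recursion for Schubert polynomials that stays in `S_n`. -/
inductive IsSchubertIn (n : ℕ+) : SInf → MvPolynomial ℕ+ ℤ → Prop
  | long : IsSchubertIn n (longElement n) (longMonomial n)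
  | step (w : SInf) (f : MvPolynomial ℕ+ ℤ) (i : ℕ+) (hf : IsSchubertIn n w f)
      (hi : Desc w i) : IsSchubertIn n (w * s i) (N i f)

theorem IsSchubertIn.fixes {n : ℕ+} {w : SInf} {f : MvPolynomial ℕ+ ℤ}
    (h : IsSchubertIn n w f) : Fixes n w := by
  induction h with
  | long => exact fixes_longElement n
  | step w f i _ hi ih => exact ih.mul_s (ih.lt_of_desc hi)

theorem IsSchubertIn.isSchubert {n : ℕ+} {w : SInf} {f : MvPolynomial ℕ+ ℤ}
    (h : IsSchubertIn n w f) : IsSchubert w f := by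
  induction h with
  | long => exact .long n
  | step w f i _ hi ih => exact .step w f i ih hi

theorem IsSchubertIn.of_asc {n i : ℕ+} {w : SInf} {f : MvPolynomial ℕ+ ℤ}
    (h : IsSchubertIn n (w * s i) f) (hi : ¬ Desc w i) : IsSchubertIn n w (N i f) := by
  have := h.step _ _ i (desc_mul_s.2 hi)
  rwa [mul_s_mul_s] at this

theorem exists_isSchubertIn {n : ℕ+} {w : SInf} (hw : Fixes n w) : ∃ f, IsSchubertIn n w f := by
  induction hk : weightedSum n w using Nat.strong_induction_on generalizing w with
  | _ k ih =>
    by_cases h : ∀ i < n, Desc w i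
    · rw [hw.eq_longElement h]
      exact ⟨_, .long⟩
    · push Not at h
      obtain ⟨i, hi, hd⟩ := h
      obtain ⟨f, hf⟩ := ih _ (hk ▸ weightedSum_lt hi hd) (hw.mul_s hi) rfl
      exact ⟨_, hf.of_asc hd⟩

theorem IsSchubertIn.eq_or {n : ℕ+} {w : SInf} {f : MvPolynomial ℕ+ ℤ}
    (h : IsSchubertIn n w f) : (w = longElement n ∧ f = longMonomial n) ∨
      ∃ i g, i < n ∧ ¬ Desc w i ∧ IsSchubertIn n (w * s i) g ∧ f = N i g := by
  cases h with
  | long => exact .inl ⟨rfl, rfl⟩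
  | step w f i hf hi =>
    exact .inr ⟨i, f, hf.fixes.lt_of_desc hi, by rwa [desc_mul_s, not_not],
      by rwa [mul_s_mul_s], rfl⟩

/-- A diamond argument. If `w` has ascents at `i` and `j`, then `w s_i` and `w s_j` both lie below a
common element: `w s_i s_j` when the indices are far apart, `w s_i s_{i+1} s_i` when they are
adjacent. A polynomial assigned there determines, by induction, those at `w s_i` and `w s_j`, and
the relations between the `N_i` make the two results at `w` agree. -/
theorem IsSchubertIn.unique {n : ℕ+} {w : SInf} {f g : MvPolynomial ℕ+ ℤ}
    (hf : IsSchubertIn n w f) (hg : IsSchubertIn n w g) : f = g := by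
  induction hk : weightedSum n w using Nat.strong_induction_on generalizing w f g with
  | _ k ih =>
    subst hk
    have IH : ∀ i, i < n → ¬ Desc w i → ∀ f g, IsSchubertIn n (w * s i) f →
        IsSchubertIn n (w * s i) g → f = g :=
      fun i hi hd f g hf hg => ih _ (weightedSum_lt hi hd) hf hg rfl
    have hw := hf.fixes
    have diamond : ∀ i j f g, i < j → i < n → j < n → ¬ Desc w i → ¬ Desc w j →
        IsSchubertIn n (w * s i) f → IsSchubertIn n (w * s j) g → N i f = N j g := by
      intro i j f g hij hi hj hdi hdj hf hg
      rcases (PNat.add_one_le_iff.2 hij).eq_or_lt with e | hlt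
      · subst e
        obtain ⟨e, he⟩ := exists_isSchubertIn
          (((hw.mul_s hi).mul_s hj).mul_s hi)
        have hab := not_desc_iff.1 hdi
        have hbc := not_desc_iff.1 hdj
        have h1 : i < i + 1 := PNat.lt_add_right i 1
        have h2 : i + 1 < i + 1 + 1 := PNat.lt_add_right _ 1
        have he' : IsSchubertIn n (w * s (i + 1) * s i * s (i + 1)) e := by
          have : w * s (i + 1) * s i * s (i + 1) = w * s i * s (i + 1) * s i := by
            simp only [mul_assoc]
            rw [← mul_assoc (s i), s_braid, mul_assoc]
          rwa [this]
        have g1 := (he.of_asc (by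
          rw [not_desc_iff, mul_s_left, mul_s_of_ne _ h1.ne (h1.trans h2).ne, mul_s_left,
            mul_s_of_ne _ (h1.trans h2).ne' h2.ne']
          exact hbc)).of_asc (by
          rw [not_desc_iff, mul_s_right, mul_s_of_ne _ (h1.trans h2).ne' h2.ne']
          exact hab.trans hbc)
        have g2 := (he'.of_asc (by
          rw [not_desc_iff, mul_s_right, mul_s_of_ne _ (h1.trans h2).ne' h2.ne',
            mul_s_of_ne _ h1.ne (h1.trans h2).ne, mul_s_right]
          exact hab)).of_asc (by
          rw [not_desc_iff, mul_s_left, mul_s_of_ne _ h1.ne (h1.trans h2).ne]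
          exact hab.trans hbc)
        rw [IH _ hi hdi _ _ hf g1, IH _ hj hdj _ _ hg g2, N_braid]
      · obtain ⟨e, he⟩ := exists_isSchubertIn ((hw.mul_s hi).mul_s hj)
        have he' : IsSchubertIn n (w * s j * s i) e := by
          rwa [mul_assoc, ← s_comm hlt, ← mul_assoc]
        have g1 := he.of_asc (by rwa [desc_mul_s_of_far hlt])
        have g2 := he'.of_asc (by rwa [desc_mul_s_of_far' hlt])
        rw [IH _ hi hdi _ _ hf g1, IH _ hj hdj _ _ hg g2, N_comm hlt]
    rcases hf.eq_or with ⟨e, rfl⟩ | ⟨i, f', hi, hdi, hf', rfl⟩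
    · rcases hg.eq_or with ⟨-, rfl⟩ | ⟨j, g', hj, hdj, hg', rfl⟩
      · rfl
      · exact absurd (e ▸ desc_longElement hj) hdj
    · rcases hg.eq_or with ⟨e, rfl⟩ | ⟨j, g', hj, hdj, hg', rfl⟩
      · exact absurd (e ▸ desc_longElement hi) hdi
      · rcases lt_trichotomy i j with h | h | h
        · exact diamond i j _ _ h hi hj hdi hdj hf' hg'
        · subst h
          rw [IH i hi hdi _ _ hf' hg']
        · exact (diamond j i _ _ h hj hi hdj hdi hg' hf').symm

/-! ### Stability -/

/-- The product is `x_i` times a polynomial `g` symmetric in `x_i, x_{i+1}`, so `N_i` returns `g`.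
-/
theorem N_prod_X_pow {m i : ℕ+} (h : i < m) {e e' : ℕ+ → ℕ} (h1 : e i = e (i + 1) + 1)
    (h2 : e' i = e (i + 1)) (h3 : ∀ j, j ≠ i → e' j = e j) :
    N i (∏ j ∈ Finset.Icc 1 m, X j ^ e j) = ∏ j ∈ Finset.Icc 1 m, X j ^ e' j := by
  have m0 : i ∈ Finset.Icc 1 m := Finset.mem_Icc.2 ⟨one_le, h.le⟩
  have m1 : i + 1 ∈ (Finset.Icc 1 m).erase i :=
    Finset.mem_erase.2 ⟨(ne_add_one i).symm,
      Finset.mem_Icc.2 ⟨one_le, PNat.add_one_le_iff.2 h⟩⟩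
  have hrest : ∏ j ∈ ((Finset.Icc 1 m).erase i).erase (i + 1), (X j : MvPolynomial ℕ+ ℤ) ^ e' j =
      ∏ j ∈ ((Finset.Icc 1 m).erase i).erase (i + 1), X j ^ e j :=
    Finset.prod_congr rfl fun j hj => by
      rw [h3 j (Finset.mem_erase.1 (Finset.mem_erase.1 hj).2).1]
  rw [← Finset.mul_prod_erase _ _ m0, ← Finset.mul_prod_erase _ _ m1,
    ← Finset.mul_prod_erase _ (fun j => X j ^ e' j) m0,
    ← Finset.mul_prod_erase _ (fun j => X j ^ e' j) m1, hrest, h1, h2,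
    h3 _ (ne_add_one i).symm]
  set r : MvPolynomial ℕ+ ℤ :=
    ∏ j ∈ ((Finset.Icc 1 m).erase i).erase (i + 1), X j ^ e j with hr
  have hs : swapVars i r = r := by
    rw [hr]
    unfold swapVars
    rw [map_prod]
    refine Finset.prod_congr rfl fun j hj => ?_
    obtain ⟨hj, hj'⟩ := Finset.mem_erase.1 hj
    rw [map_pow, rename_X, Equiv.swap_apply_of_ne_of_ne (Finset.mem_erase.1 hj').1 hj]
  set g : MvPolynomial ℕ+ ℤ := X i ^ e (i + 1) * (X (i + 1) ^ e (i + 1) * r) with hg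
  have hsg : swapVars i g = g := by
    have hpow : ∀ (p : MvPolynomial ℕ+ ℤ) (k : ℕ), swapVars i (p ^ k) = swapVars i p ^ k :=
      fun p k => map_pow _ p k
    rw [hg, swapVars_mul, swapVars_mul, hpow, hpow, swapVars_X_left, swapVars_X_right, hs]
    ring
  have hx : (X i ^ (e (i + 1) + 1) * (X (i + 1) ^ e (i + 1) * r) : MvPolynomial ℕ+ ℤ) =
      X i * g := by
    rw [hg]; ring
  rw [hx, N_mul, N_eq_zero_iff.2 hsg, N_X, if_pos rfl, if_neg (ne_add_one i)]
  simp

/-- This is the state after applying `N_1, …, N_k` to the long element of `S_{n+1}`: the value `n +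
1` has moved from position 1 to position `k + 1`, and each of `x_1, …, x_k` has lost one power. At
`k = n` the long element of `S_n` appears. -/
theorem exists_isSchubertIn_succ (n : ℕ+) (k : ℕ) (hk : k ≤ n) :
    ∃ u : SInf, IsSchubertIn (n + 1) u (∏ j ∈ Finset.Icc 1 (n + 1),
        X j ^ (if (j : ℕ) ≤ k then (n : ℕ) - j else n + 1 - j)) ∧
      ∀ j ≤ n + 1, (((u : Equiv.Perm ℕ+) j : ℕ+) : ℕ) =
        if (j : ℕ) ≤ k then (n : ℕ) + 1 - j else if (j : ℕ) = k + 1 then (n : ℕ) + 1 else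
          (n : ℕ) + 2 - j := by
  induction k with
  | zero =>
    refine ⟨longElement (n + 1), ?_, fun j hj => ?_⟩
    · have : (∏ j ∈ Finset.Icc 1 (n + 1), (X j : MvPolynomial ℕ+ ℤ) ^
          (if (j : ℕ) ≤ 0 then (n : ℕ) - j else n + 1 - j)) = longMonomial (n + 1) :=
        Finset.prod_congr rfl fun j _ => by
          rw [if_neg (not_le.2 j.pos), PNat.add_coe, PNat.one_coe]
      rw [this]
      exact .long
    · have := j.pos
      rw [coe_longElement_apply hj, PNat.add_coe, PNat.one_coe]
      split_ifs <;> omega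
  | succ k ih =>
    obtain ⟨u, hu, hv⟩ := ih (by omega)
    set i : ℕ+ := k.succPNat with hi
    have hik : (i : ℕ) = k + 1 := rfl
    have hi1 : ((i + 1 : ℕ+) : ℕ) = k + 2 := rfl
    have hin : i < n + 1 := by
      rw [← PNat.coe_lt_coe, hik, PNat.add_coe, PNat.one_coe]; omega
    have vi := hv i hin.le
    have vi1 := hv (i + 1) (PNat.add_one_le_iff.2 hin)
    rw [hik, if_neg (by omega), if_pos rfl] at vi
    rw [hi1, if_neg (by omega), if_neg (by omega)] at vi1
    have hd : Desc u i := by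
      rw [Desc, ← PNat.coe_lt_coe, vi, vi1]; omega
    refine ⟨u * s i, ?_, fun j hj => ?_⟩
    · have := hu.step _ _ i hd
      rwa [N_prod_X_pow (e' := fun j : ℕ+ => if (j : ℕ) ≤ k + 1 then (n : ℕ) - j else n + 1 - j)
        hin] at this
      · rw [hik, hi1, if_neg (by omega), if_neg (by omega)]; omega
      · simp only [hik, hi1]
        rw [if_pos le_rfl, if_neg (by omega)]; omega
      · intro j hj
        have : (j : ℕ) ≠ k + 1 := fun e => hj (PNat.eq (e.trans hik.symm))
        split_ifs <;> first | rfl | omega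
    · by_cases e : j = i
      · rw [e, mul_s_left, vi1, hik, if_pos le_rfl]; omega
      by_cases e' : j = i + 1
      · rw [e', mul_s_right, vi, hi1, if_neg (by omega), if_pos rfl]
      · have h1 : (j : ℕ) ≠ k + 1 := fun h => e (PNat.eq (h.trans hik.symm))
        have h2 : (j : ℕ) ≠ k + 2 := fun h => e' (PNat.eq (h.trans hi1.symm))
        rw [mul_s_of_ne _ e e', hv j hj]
        split_ifs <;> omega

theorem isSchubertIn_succ_longElement (n : ℕ+) :
    IsSchubertIn (n + 1) (longElement n) (longMonomial n) := by
  obtain ⟨u, hu, hv⟩ := exists_isSchubertIn_succ n n le_rfl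
  have hn : ((n + 1 : ℕ+) : ℕ) = n + 1 := rfl
  have e : u = longElement n := by
    apply Subtype.ext
    apply Equiv.ext
    intro j
    rcases le_or_gt j n with h | h
    · apply PNat.eq
      rw [hv j (h.trans (PNat.lt_add_right n 1).le), coe_longElement_apply h,
        if_pos (PNat.coe_le_coe _ _ |>.2 h)]
    · rw [fixes_longElement n j h]
      rcases (PNat.add_one_le_iff.2 h).eq_or_lt with e | h'
      · subst e
        apply PNat.eq
        rw [hv _ le_rfl, hn, if_neg (by omega), if_pos rfl]
      · exact hu.fixes j h'
  have e' : (∏ j ∈ Finset.Icc 1 (n + 1), (X j : MvPolynomial ℕ+ ℤ) ^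
      (if (j : ℕ) ≤ n then (n : ℕ) - j else n + 1 - j)) = longMonomial n := by
    have hsub : Finset.Icc 1 n ⊆ Finset.Icc 1 (n + 1) :=
      Finset.Icc_subset_Icc_right (PNat.lt_add_right n 1).le
    rw [longMonomial, ← Finset.prod_subset hsub]
    · refine Finset.prod_congr rfl fun j hj => ?_
      rw [if_pos (PNat.coe_le_coe _ _ |>.2 (Finset.mem_Icc.1 hj).2)]
    · intro j _ hj
      have hj' : n < j := by
        by_contra! h
        exact hj (Finset.mem_Icc.2 ⟨one_le, h⟩)
      have : (n : ℕ) < j := hj'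
      rw [if_neg (by omega), show (n : ℕ) + 1 - j = 0 by omega, pow_zero]
  rwa [e, e'] at hu

theorem IsSchubertIn.succ {n : ℕ+} {w : SInf} {f : MvPolynomial ℕ+ ℤ}
    (h : IsSchubertIn n w f) : IsSchubertIn (n + 1) w f := by
  induction h with
  | long => exact isSchubertIn_succ_longElement n
  | step w f i _ hi ih => exact ih.step _ _ i hi

theorem IsSchubertIn.mono {n m : ℕ+} {w : SInf} {f : MvPolynomial ℕ+ ℤ}
    (h : IsSchubertIn n w f) (hnm : n ≤ m) : IsSchubertIn m w f := by
  induction m using PNat.recOn with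
  | one => rwa [le_antisymm hnm one_le] at h
  | succ m ih =>
    rcases hnm.eq_or_lt with e | hlt
    · exact e ▸ h
    · exact (ih (PNat.lt_add_one_iff.1 hlt)).succ

theorem IsSchubert.exists_isSchubertIn {w : SInf} {f : MvPolynomial ℕ+ ℤ}
    (h : IsSchubert w f) : ∃ n, IsSchubertIn n w f := by
  induction h with
  | long n => exact ⟨n, .long⟩
  | step w f i _ hi ih =>
    obtain ⟨n, hn⟩ := ih
    exact ⟨n, hn.step _ _ i hi⟩

theorem IsSchubert.unique {w : SInf} {f g : MvPolynomial ℕ+ ℤ}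
    (hf : IsSchubert w f) (hg : IsSchubert w g) : f = g := by
  obtain ⟨n, hn⟩ := hf.exists_isSchubertIn
  obtain ⟨m, hm⟩ := hg.exists_isSchubertIn
  exact (hn.mono (le_max_left n m)).unique (hm.mono (le_max_right n m))

/-! ### Schubert polynomials -/

theorem existsUnique_isSchubert (w : SInf) : ∃! f, IsSchubert w f := by
  obtain ⟨n, hn⟩ := exists_fixes w
  obtain ⟨f, hf⟩ := exists_isSchubertIn hn
  exact ⟨f, hf.isSchubert, fun g hg => hg.unique hf.isSchubert⟩

theorem isSchubert_schubert (w : SInf) : IsSchubert w (schubert w) := by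
  rw [schubert, dif_pos (existsUnique_isSchubert w)]
  exact (existsUnique_isSchubert w).choose_spec.1

theorem N_schubert_of_desc {w : SInf} {i : ℕ+} (h : Desc w i) :
    N i (schubert w) = schubert (w * s i) :=
  ((isSchubert_schubert w).step _ _ i h).unique (isSchubert_schubert _)

/-- Here `𝔖_w` is itself in the image of `N_i`, whose square is 0. -/
theorem N_schubert_of_not_desc {w : SInf} {i : ℕ+} (h : ¬ Desc w i) : N i (schubert w) = 0 := by
  have := N_schubert_of_desc (desc_mul_s.2 h)
  rw [mul_s_mul_s] at this
  rw [← this, N_N]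

theorem schubert_one : schubert 1 = 1 := by
  have e : longElement 1 = 1 := eq_one_of_forall_not_desc fun i hi =>
    absurd ((fixes_longElement 1).lt_of_desc hi) (not_lt.2 one_le)
  have h := IsSchubert.long 1
  rw [e] at h
  rw [(isSchubert_schubert 1).unique h]
  simp

theorem schubert_ne_zero (w : SInf) : schubert w ≠ 0 := by
  induction w using desc_induction with
  | h w ih =>
    by_cases hw : w = 1
    · rw [hw, schubert_one]
      exact one_ne_zero
    · obtain ⟨i, hi⟩ := exists_desc hw
      intro h
      apply ih i hi
      rw [← N_schubert_of_desc hi, h, N_zero]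

theorem IsSchubert.exists_isHomogeneous {w : SInf} {f : MvPolynomial ℕ+ ℤ}
    (h : IsSchubert w f) : ∃ d, f.IsHomogeneous d := by
  induction h with
  | long n =>
    exact ⟨_, IsHomogeneous.prod _ _ _ fun j _ => (isHomogeneous_X_pow j _)⟩
  | step w f i hf hi ih =>
    obtain ⟨d, hd⟩ := ih
    cases d with
    -- A constant is killed by `N_i`, and 0 counts as homogeneous of degree 0, so no length function
    -- is needed.
    | zero =>
      refine ⟨0, ?_⟩
      rw [totalDegree_eq_zero_iff_eq_C.1 (Nat.le_zero.1 hd.totalDegree_le), N_C]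
      exact isHomogeneous_zero _ _ _
    | succ d => exact ⟨d, isHomogeneous_N hd⟩

/-- In degree 0 the polynomial would be constant, so `N_i` at a descent would kill it, contradicting
`schubert_ne_zero`. -/
theorem constantCoeff_schubert {w : SInf} (hw : w ≠ 1) : constantCoeff (schubert w) = 0 := by
  obtain ⟨d, hd⟩ := (isSchubert_schubert w).exists_isHomogeneous
  rcases Nat.eq_zero_or_pos d with rfl | h
  · obtain ⟨i, hi⟩ := exists_desc hw
    refine absurd ?_ (schubert_ne_zero (w * s i))
    rw [← N_schubert_of_desc hi,
      totalDegree_eq_zero_iff_eq_C.1 (Nat.le_zero.1 hd.totalDegree_le), N_C]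
  · rw [constantCoeff_eq]
    exact hd.coeff_eq_zero (by simpa using h.ne)

/-! ### Schubert polynomials form a basis -/

theorem ne_one_of_desc {w : SInf} {i : ℕ+} (h : Desc w i) : w ≠ 1 := by
  rintro rfl
  exact absurd h (not_desc_iff.2 (PNat.lt_add_right i 1))

open Classical in
/-- The divided difference operator in the coordinates of the Schubert polynomials. -/
noncomputable def descShift (i : ℕ+) : (SInf →₀ ℤ) →ₗ[ℤ] (SInf →₀ ℤ) :=
  Finsupp.linearCombination ℤ fun w => if Desc w i then Finsupp.single (w * s i) 1 else 0

theorem N_linearCombination (i : ℕ+) (c : SInf →₀ ℤ) :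
    N i (Finsupp.linearCombination ℤ schubert c) =
      Finsupp.linearCombination ℤ schubert (descShift i c) := by
  rw [← NLin_apply]
  induction c using Finsupp.induction_linear with
  | zero => simp only [map_zero]
  | add c d hc hd => simp only [map_add, hc, hd]
  | single w a =>
    rw [descShift, Finsupp.linearCombination_single, Finsupp.linearCombination_single, map_smul,
      map_smul, NLin_apply]
    split_ifs with h
    · rw [N_schubert_of_desc h, Finsupp.linearCombination_single, one_smul]
    · rw [N_schubert_of_not_desc h, map_zero]

open Classical in
theorem descShift_apply (i : ℕ+) (c : SInf →₀ ℤ) (u : SInf) :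
    descShift i c u = if Desc u i then 0 else c (u * s i) := by
  induction c using Finsupp.induction_linear with
  | zero => simp
  | add c d hc hd =>
    rw [map_add, Finsupp.add_apply, hc, hd]
    split_ifs <;> simp
  | single w a =>
    rw [descShift, Finsupp.linearCombination_single]
    by_cases e : w = u * s i
    · subst e
      rw [desc_mul_s, mul_s_mul_s]
      split_ifs <;> simp
    · have e' : w * s i ≠ u := by
        rintro rfl
        exact e (mul_s_mul_s w i).symm
      split_ifs <;> simp [e, e']

theorem descShift_apply_of_desc {i : ℕ+} {u : SInf} (h : Desc u i) (c : SInf →₀ ℤ) :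
    descShift i c u = 0 := by
  rw [descShift_apply, if_pos h]

theorem descShift_apply_of_not_desc {i : ℕ+} {u : SInf} (h : ¬ Desc u i) (c : SInf →₀ ℤ) :
    descShift i c u = c (u * s i) := by
  rw [descShift_apply, if_neg h]

theorem descShift_mul_s {i : ℕ+} {u : SInf} (h : Desc u i) (c : SInf →₀ ℤ) :
    descShift i c (u * s i) = c u := by
  rw [descShift_apply_of_not_desc (by rwa [desc_mul_s, not_not]), mul_s_mul_s]

/-- Divided differences along descents carry the coordinate at `u` to the one at the identity, which
is the constant term. -/
theorem eq_zero_of_linearCombination_eq_zero (u : SInf) :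
    ∀ c : SInf →₀ ℤ, Finsupp.linearCombination ℤ schubert c = 0 → c u = 0 := by
  induction u using desc_induction with
  | h u ih =>
    intro c hc
    by_cases hu : u = 1
    · subst hu
      have h := congrArg constantCoeff hc
      rw [Finsupp.linearCombination_apply, Finsupp.sum, map_sum, map_zero,
        Finset.sum_eq_single 1] at h
      · simpa [schubert_one] using h
      · intro w _ hw
        rw [smul_eq_C_mul, map_mul, constantCoeff_schubert hw, mul_zero]
      · intro h1
        rw [Finsupp.notMem_support_iff.1 h1, zero_smul, map_zero]
    · obtain ⟨i, hi⟩ := exists_desc hu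
      rw [← descShift_mul_s hi]
      exact ih i hi _ (by rw [← N_linearCombination, hc, N_zero])

theorem linearIndependent_schubert : LinearIndependent ℤ schubert :=
  linearIndependent_iff.2 fun c hc =>
    Finsupp.ext fun u => eq_zero_of_linearCombination_eq_zero u c hc

theorem linearCombination_injective :
    Function.Injective (Finsupp.linearCombination ℤ schubert) :=
  linearIndependent_schubert

theorem finite_setOf_N_ne_zero (f : MvPolynomial ℕ+ ℤ) : {i | N i f ≠ 0}.Finite := by
  obtain ⟨M, hM⟩ := f.vars.bddAbove
  refine (Set.finite_Iic M).subset fun i hi => ?_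
  by_contra hlt
  rw [Set.mem_Iic, not_le] at hlt
  refine hi (N_eq_zero_iff.2 ?_)
  refine hom_congr_vars (f₁ := (rename (R := ℤ) (Equiv.swap i (i + 1))).toRingHom)
    (f₂ := RingHom.id _) (by ext; simp) (fun j hj _ => ?_) rfl
  have hji : j < i := (hM hj).trans_lt hlt
  exact (rename_X _ _).trans (congrArg X
    (Equiv.swap_apply_of_ne_of_ne hji.ne (hji.trans (PNat.lt_add_right i 1)).ne))

/-- Coordinates of the divided differences of one polynomial agree wherever they should. -/
theorem coordinates_compatible {f : MvPolynomial ℕ+ ℤ} {c : ℕ+ → SInf →₀ ℤ}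
    (hc : ∀ i, Finsupp.linearCombination ℤ schubert (c i) = N i f) {u : SInf} {i j : ℕ+}
    (hij : i < j) (hi : Desc u i) (hj : Desc u j) : c i (u * s i) = c j (u * s j) := by
  rcases (PNat.add_one_le_iff.2 hij).eq_or_lt with e | hlt
  · subst e
    have h1 : i < i + 1 := PNat.lt_add_right i 1
    have h2 : i + 1 < i + 1 + 1 := PNat.lt_add_right _ 1
    -- Both coordinates are transported to the common element `u s_i s_{i+1} s_i`, where the braid
    -- relation compares them.
    have hd : descShift i (descShift (i + 1) (c i)) =
        descShift (i + 1) (descShift i (c (i + 1))) := by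
      apply linearCombination_injective
      simp only [← N_linearCombination, hc, N_braid]
    have d1 : Desc (u * s i) (i + 1) := by
      rw [Desc, mul_s_right, mul_s_of_ne _ (h1.trans h2).ne' h2.ne']
      exact lt_trans hj hi
    have d2 : Desc (u * s i * s (i + 1)) i := by
      rw [Desc, mul_s_left, mul_s_of_ne _ h1.ne (h1.trans h2).ne, mul_s_left,
        mul_s_of_ne _ (h1.trans h2).ne' h2.ne']
      exact hj
    have d3 : Desc (u * s (i + 1)) i := by
      rw [Desc, mul_s_left, mul_s_of_ne _ h1.ne (h1.trans h2).ne]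
      exact lt_trans hj hi
    have d4 : Desc (u * s (i + 1) * s i) (i + 1) := by
      rw [Desc, mul_s_right, mul_s_of_ne _ (h1.trans h2).ne' h2.ne', mul_s_right,
        mul_s_of_ne _ h1.ne (h1.trans h2).ne]
      exact hi
    have hy : u * s i * s (i + 1) * s i = u * s (i + 1) * s i * s (i + 1) := by
      rw [mul_assoc, mul_assoc, ← mul_assoc (s i), s_braid]
      simp only [mul_assoc]
    rw [← descShift_mul_s d1, ← descShift_mul_s d2, hd, hy, descShift_mul_s d4,
      descShift_mul_s d3]
  · have hd : descShift j (c i) = descShift i (c j) := by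
      apply linearCombination_injective
      simp only [← N_linearCombination, hc, N_comm hlt]
    rw [← descShift_mul_s ((desc_mul_s_of_far hlt).2 hj), hd, mul_assoc, s_comm hlt, ← mul_assoc,
      descShift_mul_s ((desc_mul_s_of_far' hlt).2 hi)]

/-- Integration by induction on the degree. The coordinate of `f` at `u` must be that of `N_i f` at
`u s_i` for any descent `i` of `u`. These prescriptions agree, and the combination they define
differs from `f` by a common zero of all `N_i`, a constant. -/
theorem exists_eq_linearCombination (f : MvPolynomial ℕ+ ℤ) :
    ∃ c, Finsupp.linearCombination ℤ schubert c = f := by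
  classical
  induction hd : f.totalDegree using Nat.strong_induction_on generalizing f with
  | _ d ih =>
    have hN : ∀ i, ∃ c, Finsupp.linearCombination ℤ schubert c = N i f := by
      intro i
      by_cases h : N i f = 0
      · exact ⟨0, by rw [h, map_zero]⟩
      · exact ih _ (hd ▸ totalDegree_N_lt h) _ rfl
    choose c hc using hN
    have compat : ∀ u i j, Desc u i → Desc u j → c i (u * s i) = c j (u * s j) := by
      intro u i j hi hj
      rcases lt_trichotomy i j with h | h | h
      · exact coordinates_compatible hc h hi hj
      · rw [h]
      · exact (coordinates_compatible hc h hj hi).symm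
    -- The identity has no descent; its value 0 is provisional and is corrected by the constant `a`
    -- below.
    let F : SInf → ℤ := fun u =>
      if h : ∃ i, Desc u i then c h.choose (u * s h.choose) else 0
    have hF : ∀ u i, Desc u i → F u = c i (u * s i) := by
      intro u i hi
      have h : ∃ i, Desc u i := ⟨i, hi⟩
      rw [show F u = c h.choose (u * s h.choose) from dif_pos h]
      exact compat u _ _ h.choose_spec hi
    have hfin : (Function.support F).Finite := by
      refine ((finite_setOf_N_ne_zero f).biUnion fun i _ =>
        ((c i).support.image (· * s i)).finite_toSet).subset fun u hu => ?_
      by_cases h : ∃ i, Desc u i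
      · obtain ⟨i, hi⟩ := h
        rw [Function.mem_support, hF u i hi] at hu
        refine Set.mem_biUnion (x := i) ?_ ?_
        · intro h0
          have : c i = 0 := linearCombination_injective (by rw [hc, h0, map_zero])
          rw [this] at hu
          exact hu rfl
        · exact Finset.mem_coe.2 (Finset.mem_image.2
            ⟨_, Finsupp.mem_support_iff.2 hu, mul_s_mul_s u i⟩)
      · exact absurd (dif_neg h) hu
    let g : SInf →₀ ℤ := Finsupp.ofSupportFinite F hfin
    have hg : ∀ i, descShift i g = c i := by
      intro i
      ext u
      by_cases h : Desc u i
      -- As `N_i (N_i f) = 0`, the coordinates of `N_i f` vanish at every `u` with a descent at `i`.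
      · have h0 : descShift i (c i) = 0 := by
          apply linearCombination_injective
          rw [← N_linearCombination, hc, N_N, map_zero]
        rw [descShift_apply_of_desc h, ← descShift_mul_s h, h0, Finsupp.zero_apply]
      · rw [descShift_apply_of_not_desc h]
        change F (u * s i) = _
        rw [hF _ i (desc_mul_s.2 h), mul_s_mul_s]
    obtain ⟨a, ha⟩ := eq_C_of_forall_N_eq_zero
      (f := f - Finsupp.linearCombination ℤ schubert g) fun i => by
        rw [← NLin_apply, map_sub, NLin_apply, NLin_apply, N_linearCombination, hg, hc, sub_self]
    refine ⟨g + Finsupp.single 1 a, ?_⟩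
    rw [map_add, Finsupp.linearCombination_single, schubert_one, smul_eq_C_mul, mul_one, ← ha,
      add_sub_cancel]

/-- The basis of Schubert polynomials. -/
noncomputable def schubertBasis : Module.Basis SInf ℤ (MvPolynomial ℕ+ ℤ) :=
  Module.Basis.mk linearIndependent_schubert fun f _ => by
    obtain ⟨c, hc⟩ := exists_eq_linearCombination f
    rw [Finsupp.mem_span_range_iff_exists_finsupp]
    exact ⟨c, hc⟩

theorem schubertBasis_apply (w : SInf) : schubertBasis w = schubert w :=
  Module.Basis.mk_apply _ _ w

theorem linearCombination_repr (f : MvPolynomial ℕ+ ℤ) :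
    Finsupp.linearCombination ℤ schubert (schubertBasis.repr f) = f := by
  have := schubertBasis.linearCombination_repr f
  rwa [show (schubertBasis : SInf → MvPolynomial ℕ+ ℤ) = schubert from
    funext schubertBasis_apply] at this

theorem structureCoeff_eq (u v : SInf) :
    structureCoeff u v = schubertBasis.repr (schubert u * schubert v) := by
  have h : ∃! c : SInf →₀ ℤ, schubert u * schubert v = c.sum (fun w a => a • schubert w) :=
    ⟨schubertBasis.repr (schubert u * schubert v), (linearCombination_repr _).symm,
      fun c hc => linearCombination_injective
        (hc.symm.trans (linearCombination_repr _).symm)⟩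
  rw [structureCoeff, dif_pos h]
  exact linearCombination_injective
    (h.choose_spec.1.symm.trans (linearCombination_repr _).symm)

theorem repr_schubert (w : SInf) : schubertBasis.repr (schubert w) = Finsupp.single w 1 := by
  rw [← schubertBasis_apply, Module.Basis.repr_self]

theorem repr_N_mul_s {w : SInf} {i : ℕ+} (h : Desc w i) (f : MvPolynomial ℕ+ ℤ) :
    schubertBasis.repr (N i f) (w * s i) = schubertBasis.repr f w := by
  have e : schubertBasis.repr (N i f) = descShift i (schubertBasis.repr f) := by
    apply linearCombination_injective
    rw [← N_linearCombination, linearCombination_repr, linearCombination_repr]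
  rw [e, descShift_mul_s h]

/-! ### Products with linear forms -/

theorem desc_s (k : ℕ+) : Desc (s k) k := by
  have := (desc_mul_s (w := 1) (i := k)).2 (not_desc_iff.2 (PNat.lt_add_right k 1))
  rwa [one_mul] at this

/-- An adjacent transposition reverses the order of no pair but `(k, k + 1)`. -/
theorem swap_lt_swap {k a b : ℕ+} (h : a < b) (hne : ¬ (a = k ∧ b = k + 1)) :
    Equiv.swap k (k + 1) a < Equiv.swap k (k + 1) b := by
  have h1 : k < k + 1 := PNat.lt_add_right k 1
  by_cases hb : b = k
  · subst hb
    rw [Equiv.swap_apply_left, Equiv.swap_apply_of_ne_of_ne h.ne (h.trans h1).ne]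
    exact h.trans h1
  by_cases hb' : b = k + 1
  · subst hb'
    have hak : a ≠ k := fun e => hne ⟨e, rfl⟩
    rw [Equiv.swap_apply_right, Equiv.swap_apply_of_ne_of_ne hak h.ne]
    exact (PNat.lt_add_one_iff.1 h).lt_of_ne hak
  rw [Equiv.swap_apply_of_ne_of_ne hb hb']
  by_cases hak : a = k
  · subst hak
    rw [Equiv.swap_apply_left]
    exact (PNat.add_one_le_iff.2 h).lt_of_ne (Ne.symm hb')
  by_cases hak' : a = k + 1
  · subst hak'
    rw [Equiv.swap_apply_right]
    exact h1.trans h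
  rwa [Equiv.swap_apply_of_ne_of_ne hak hak']

theorem desc_s_mul {v : SInf} {k i : ℕ+}
    (hk : (v : Equiv.Perm ℕ+).symm k < (v : Equiv.Perm ℕ+).symm (k + 1)) (hi : Desc v i) :
    Desc (s k * v) i := by
  refine swap_lt_swap hi ?_
  rintro ⟨h1, h2⟩
  rw [← h2, ← h1, Equiv.symm_apply_apply, Equiv.symm_apply_apply] at hk
  exact absurd hk (not_lt.2 (PNat.lt_add_right i 1).le)

/-- At a descent `i` of `v`, which is also one of `s_k v`, apply `N_i (x_r 𝔖_v) = N_i(x_r) 𝔖_v +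
x_{s_i(r)} 𝔖_{v s_i}`. The first term does not contain `𝔖_{s_k v s_i}`, and the second is the same
problem for `v s_i`. At `v = 1` the coefficient of `𝔖_{s_k}` in `x_r` is `N_k x_r`. -/
theorem repr_X_mul_schubert (v : SInf) (k : ℕ+) :
    (v : Equiv.Perm ℕ+).symm k < (v : Equiv.Perm ℕ+).symm (k + 1) → ∀ r,
    schubertBasis.repr (X r * schubert v) (s k * v) =
      (if (v : Equiv.Perm ℕ+) r = k then 1 else 0) -
        (if (v : Equiv.Perm ℕ+) r = k + 1 then 1 else 0) := by
  induction v using desc_induction with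
  | h v ih =>
    intro hk r
    by_cases hv : v = 1
    · subst hv
      rw [mul_one, schubert_one, mul_one, ← repr_N_mul_s (desc_s k), s_mul_s, N_X, ← mul_one (C _),
        ← smul_eq_C_mul, map_smul, ← schubert_one, repr_schubert, Finsupp.smul_apply,
        Finsupp.single_eq_same, smul_eq_mul, mul_one]
      rfl
    · obtain ⟨i, hi⟩ := exists_desc hv
      -- The order of `k` and `k + 1` could flip only if they stood at positions `i` and `i + 1`, an
      -- ascent of `v`.
      have hki : ((v * s i : SInf) : Equiv.Perm ℕ+).symm k <
          ((v * s i : SInf) : Equiv.Perm ℕ+).symm (k + 1) := by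
        refine swap_lt_swap hk ?_
        rintro ⟨h1, h2⟩
        rw [Equiv.symm_apply_eq] at h1 h2
        rw [Desc, ← h1, ← h2] at hi
        exact absurd hi (not_lt.2 (PNat.lt_add_right k 1).le)
      -- The left side has a descent at `i`, the right side an ascent.
      have hne : v ≠ s k * v * s i := by
        intro h
        have h1 := desc_s_mul hk hi
        have h2 : Desc (s k * v * s i) i := h ▸ hi
        exact desc_mul_s.1 h2 h1
      rw [← repr_N_mul_s (desc_s_mul hk hi), N_mul, N_schubert_of_desc hi, swapVars_X, N_X,
        ← smul_eq_C_mul, map_add, map_smul, repr_schubert, Finsupp.add_apply, Finsupp.smul_apply,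
        Finsupp.single_eq_of_ne hne.symm, smul_zero, zero_add, mul_assoc, ih i hi hki,
        coe_mul_s_apply, Equiv.swap_apply_self]

/-- Both sides have the same divided differences, 1 for `N_i` and 0 otherwise, and no constant term.
-/
theorem schubert_s (i : ℕ+) : schubert (s i) = ∑ r ∈ Finset.Icc 1 i, X r := by
  have hN : ∀ j, N j (schubert (s i) - ∑ r ∈ Finset.Icc 1 i, X r) = 0 := by
    intro j
    have h2 : N j (∑ r ∈ Finset.Icc 1 i, X r) = if j = i then 1 else 0 := by
      rw [← NLin_apply, map_sum]
      simp only [NLin_apply, N_X]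
      rw [← map_sum, Finset.sum_sub_distrib, Finset.sum_ite_eq', Finset.sum_ite_eq']
      simp only [Finset.mem_Icc, one_le, true_and, PNat.add_one_le_iff]
      rcases lt_trichotomy j i with h | h | h
      · simp [h, h.le, h.ne]
      · simp [h]
      · simp [not_le.2 h, not_lt.2 h.le, h.ne']
    rw [← NLin_apply, map_sub, NLin_apply, NLin_apply, h2]
    by_cases h : j = i
    · subst h
      rw [N_schubert_of_desc (desc_s j), s_mul_s, schubert_one, if_pos rfl, sub_self]
    · rw [if_neg h, sub_zero]
      exact N_schubert_of_not_desc
        (not_desc_iff.2 (swap_lt_swap (PNat.lt_add_right j 1) fun e => h e.1))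
  obtain ⟨a, ha⟩ := eq_C_of_forall_N_eq_zero hN
  have h0 := congrArg constantCoeff ha
  rw [map_sub, constantCoeff_schubert (ne_one_of_desc (desc_s i)), map_sum, constantCoeff_C] at h0
  simp only [constantCoeff_X, Finset.sum_const_zero, sub_zero] at h0
  rw [← h0, map_zero] at ha
  exact sub_eq_zero.1 ha

theorem structureCoeff_s_mul {v : SInf} {i a b : ℕ+} (ha : a ≤ i) (hb : i < b)
    (h : (v : Equiv.Perm ℕ+) b = (v : Equiv.Perm ℕ+) a + 1) :
    structureCoeff (s i) v (s ((v : Equiv.Perm ℕ+) a) * v) = 1 := by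
  have hk : (v : Equiv.Perm ℕ+).symm ((v : Equiv.Perm ℕ+) a) <
      (v : Equiv.Perm ℕ+).symm ((v : Equiv.Perm ℕ+) a + 1) := by
    rw [← h, Equiv.symm_apply_apply, Equiv.symm_apply_apply]
    exact ha.trans_lt hb
  rw [structureCoeff_eq, schubert_s, Finset.sum_mul, map_sum, Finsupp.finsetSum_apply]
  simp only [repr_X_mul_schubert v _ hk, ← h, (v : Equiv.Perm ℕ+).injective.eq_iff]
  rw [Finset.sum_sub_distrib, Finset.sum_ite_eq', Finset.sum_ite_eq',
    if_pos (Finset.mem_Icc.2 ⟨one_le, ha⟩),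
    if_neg (fun hm => absurd (Finset.mem_Icc.1 hm).2 (not_le.2 hb)), sub_zero]

end Schubert

theorem mainTheorem6 (v : Schubert.SInf) (i : ℕ+) :
    ∃ k : ℕ+, 0 < Schubert.structureCoeff (Schubert.s i) v (Schubert.s k * v) := by
  obtain ⟨a, ha, hmax⟩ := (Finset.Icc 1 i).exists_max_image (v : Equiv.Perm ℕ+)
    ⟨i, Finset.mem_Icc.2 ⟨one_le, le_rfl⟩⟩
  refine ⟨(v : Equiv.Perm ℕ+) a, ?_⟩
  -- By maximality of `v(a)`, the next value cannot occur among the first `i` positions.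
  have hb : i < (v : Equiv.Perm ℕ+).symm ((v : Equiv.Perm ℕ+) a + 1) := by
    by_contra! hle
    have := hmax _ (Finset.mem_Icc.2 ⟨one_le, hle⟩)
    rw [Equiv.apply_symm_apply] at this
    exact absurd this (not_le.2 (PNat.lt_add_right _ 1))
  rw [Schubert.structureCoeff_s_mul (Finset.mem_Icc.1 ha).2 hb (Equiv.apply_symm_apply _ _)]
  exact one_pos
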